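/- **Law of large numbers.** Let $1\le d\le m$ be integers and $\lambda=d/m$. For monic polynomials $p,q$ of degree $d$ with nonnegative real roots, choose real $m\times d$ matrices $A,B$ with $p(x)=\det(xI-A^TA)$ and $q(x)=\det(xI-B^TB)$, and let \[ [p\boxplus_{d,\lambda}q](x)=\int_{O(m)}\int_{O(d)}\det\bigl(xI-(A+QBR^T)^T(A+QBR^T)\bigr)\,dR\,dQ , \] the integrals being with respect to the Haar probability measures on the real orthogonal groups. Let $\mathbb{S}p(x)=p(x^2)$, and for $\alpha>0$ and a polynomial $f$ let $R_\alpha f(x)=\alpha^{\deg f}f(x/\alpha)$, so that $R_\alpha$ multiplies every root by $\alpha$ and keeps the leading coefficient. Let $\sigma\in\mathbb{R}$ and let $p_1,p_2,\dots$ be polynomials of degree $d$ with nonnegative real roots and means bounded by $\sigma^2$, that is, \[ p_i(x)=\prod_{j=1}^d (x-r_{i,j}^2),\qquad r_{i,j}\in\mathbb{R},\qquad \frac1d\sum_{j=1}^d r_{i,j}^2\le\sigma^2\quad\text{for all } i\ge 1 . \] Then \[ \lim_{N\to\infty} R_{1/N}\bigl(\mathbb{S}[p_1\boxplus_{d,\lambda}\cdots\boxplus_{d,\lambda}p_N]\bigr)(x)=x^{2d},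 \] both coefficient by coefficient and pointwise for every $x\in\mathbb{C}$. -/

import Mathlib

open Polynomial MeasureTheory Filter Topology

noncomputable section

namespace RectConv

/-- The Borel `σ`-algebra of the real orthogonal group. -/
instance orthogonalMeasurableSpace (n : ℕ) :
    MeasurableSpace (Matrix.orthogonalGroup (Fin n) ℝ) := borel _

instance orthogonalBorelSpace (n : ℕ) :
    BorelSpace (Matrix.orthogonalGroup (Fin n) ℝ) := ⟨rfl⟩

instance orthogonalCompactSpace (n : ℕ) :
    CompactSpace (Matrix.orthogonalGroup (Fin n) ℝ) := by
  apply isCompact_iff_compactSpace.mp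
  have hbox : IsCompact (Set.pi Set.univ fun _ : Fin n =>
      Set.pi Set.univ fun _ : Fin n => Metric.closedBall (0 : ℝ) 1) :=
    isCompact_univ_pi fun _ => isCompact_univ_pi fun _ => isCompact_closedBall _ _
  refine IsCompact.of_isClosed_subset (s := Set.pi Set.univ fun _ : Fin n =>
      Set.pi Set.univ fun _ : Fin n => Metric.closedBall (0 : ℝ) 1) hbox ?_ ?_
  · have h : {A : Matrix (Fin n) (Fin n) ℝ | A * A.transpose = 1} =
        ((Matrix.orthogonalGroup (Fin n) ℝ : Submonoid _) : Set (Matrix (Fin n) (Fin n) ℝ)) := by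
      ext A
      exact (Matrix.mem_orthogonalGroup_iff (Fin n) ℝ).symm
    have hc : IsClosed {A : Matrix (Fin n) (Fin n) ℝ | A * A.transpose = 1} :=
      isClosed_eq (continuous_id.matrix_mul continuous_id.matrix_transpose) continuous_const
    rw [h] at hc
    exact hc
  · intro A hA i _ j _
    simpa using entry_norm_bound_of_unitary (𝕜 := ℝ) (n := Fin n) hA i j

/-- The Haar probability measure on the orthogonal group `O(n)`. -/
def haarO (n : ℕ) : Measure (Matrix.orthogonalGroup (Fin n) ℝ) :=
  Measure.haarMeasure ⊤

instance haarO_isHaarMeasure (n : ℕ) : (haarO n).IsHaarMeasure := by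
  unfold haarO; infer_instance

instance haarO_isProbabilityMeasure (n : ℕ) : IsProbabilityMeasure (haarO n) := by
  constructor
  have h := Measure.haarMeasure_self
    (K₀ := (⊤ : TopologicalSpace.PositiveCompacts (Matrix.orthogonalGroup (Fin n) ℝ)))
  simpa [haarO] using h

/-- The matrix `A + Q B Rᵀ`, for `m × d` matrices `A`, `B` and orthogonal `Q`, `R`. -/
def rotatedSum {m d : ℕ} (A B : Matrix (Fin m) (Fin d) ℂ)
    (Q : Matrix.orthogonalGroup (Fin m) ℝ) (R : Matrix.orthogonalGroup (Fin d) ℝ) :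
    Matrix (Fin m) (Fin d) ℂ :=
  A + (Q : Matrix (Fin m) (Fin m) ℝ).map Complex.ofReal * B *
    ((R : Matrix (Fin d) (Fin d) ℝ).map Complex.ofReal).transpose

/-- The average `∬ det (x I - (A + Q B Rᵀ)ᵀ (A + Q B Rᵀ)) dR dQ` over the Haar probability
measures of `O(m)` and `O(d)`. The integrand is a polynomial of degree `d` in `x`, and the
integral is taken coefficient by coefficient. -/
def haarAverage {m d : ℕ} (A B : Matrix (Fin m) (Fin d) ℂ) : ℂ[X] :=
  ∑ k ∈ Finset.range (d + 1), monomial k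
    (∫ Q, ∫ R, ((rotatedSum A B Q R).transpose * rotatedSum A B Q R).charpoly.coeff k
      ∂(haarO d) ∂(haarO m))

/-- The `m × d` rectangular diagonal matrix whose diagonal entries are the (principal) square
roots of the roots of `p`. If the roots of `p` are nonnegative reals this is a real matrix, with
the square roots of the roots of `p` as its singular values. -/
def singularMatrix (m d : ℕ) (p : ℂ[X]) : Matrix (Fin m) (Fin d) ℂ :=
  Matrix.of fun i j =>
    if (i : ℕ) = (j : ℕ) then (p.roots.toList.getD (j : ℕ) 0) ^ (1 / 2 : ℂ) else 0

/-- For every monic `p` of degree `d ≤ m`, the matrix `A = singularMatrix m d p` satisfies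
`det (x I - Aᵀ A) = p(x)`. -/
theorem charpoly_singularMatrix {m d : ℕ} (hdm : d ≤ m) {p : ℂ[X]} (hp : p.Monic)
    (hd : p.natDegree = d) :
    ((singularMatrix m d p).transpose * singularMatrix m d p).charpoly = p := by
  have hlen : p.roots.toList.length = d := by
    rw [Multiset.length_toList, ← hd]
    exact (IsAlgClosed.splits p).natDegree_eq_card_roots.symm
  have hdiag : (singularMatrix m d p).transpose * singularMatrix m d p =
      Matrix.diagonal fun j : Fin d => p.roots.toList.getD (j : ℕ) 0 := by
    ext i j
    rw [Matrix.mul_apply, Finset.sum_eq_single (Fin.castLE hdm i)]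
    · by_cases h : i = j
      · subst h
        simp only [singularMatrix, Matrix.transpose_apply, Matrix.of_apply, Fin.val_castLE,
          if_true, Matrix.diagonal_apply_eq]
        rw [← sq, ← Complex.cpow_nat_mul]
        norm_num
      · have h' : (i : ℕ) ≠ (j : ℕ) := fun e => h (Fin.ext e)
        simp [singularMatrix, Matrix.diagonal_apply_ne _ h, h']
    · intro k _ hk
      have h' : (k : ℕ) ≠ (i : ℕ) := fun e => hk (Fin.ext (by simpa using e))
      simp [singularMatrix, h']
    · simp
  rw [hdiag, Matrix.charpoly_diagonal]
  have hprod := (IsAlgClosed.splits p).eq_prod_roots_of_monic hp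
  conv_rhs => rw [hprod, ← Multiset.coe_toList p.roots]
  rw [Multiset.map_coe, Multiset.prod_coe, ← List.prod_ofFn]
  congr 1
  apply List.ext_getElem
  · simp [hlen]
  · intro k h1 h2
    have hk : k < p.roots.toList.length := by simpa using h2
    simp [List.getElem?_eq_getElem hk]

/-- The rectangular additive convolution `p ⊞ q` of polynomials of degree `d`, with matrices of
size `m × d` (that is, with parameter `λ = d / m`):
`∬ det (x I - (A + Q B Rᵀ)ᵀ (A + Q B Rᵀ)) dR dQ`, where `A` and `B` are `m × d` matrices with
`p = det (x I - Aᵀ A)` and `q = det (x I - Bᵀ B)`. For `p`, `q` with nonnegative real roots,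
`A` and `B` are real; allowing complex matrices makes the operation total on monic polynomials of
degree `d`. -/
def rectConv (m d : ℕ) (p q : ℂ[X]) : ℂ[X] :=
  haarAverage (singularMatrix m d p) (singularMatrix m d q)

/-- `rectConvSeq m d p N = p 1 ⊞ ⋯ ⊞ p N`. The value at `N = 0` is the neutral element `x ^ d`. -/
def rectConvSeq (m d : ℕ) (p : ℕ → ℂ[X]) : ℕ → ℂ[X]
  | 0 => X ^ d
  | 1 => p 1
  | N + 2 => rectConv m d (rectConvSeq m d p (N + 1)) (p (N + 2))

/-- The symmetrization `(𝕊 p)(x) = p(x²)`. -/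
def symmetrization (p : ℂ[X]) : ℂ[X] := p.comp (X ^ 2)

/-- The operator `p(x) ↦ α ^ (deg p) * p (x / α)`, which multiplies every root by `α ≠ 0` and
keeps the leading coefficient. -/
def rescale (α : ℂ) (p : ℂ[X]) : ℂ[X] :=
  C (α ^ p.natDegree) * p.comp (C α⁻¹ * X)

end RectConv

end

noncomputable section

namespace RectConv

/-! No closed formula for the convolution is needed, only the triangular shape of its coefficients.
Fix n = d - k. With A and B diagonal, the averaged n-th coefficient is a symmetric function of the
diagonal s of A, by Haar invariance under permutation matrices. It is at most quadratic in each s_i,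
since a single matrix entry enters a bordered determinant for the characteristic polynomial in two
rows only, and it is even in s_i by invariance under reflections. Hence it is a combination of the
elementary symmetric functions e_w(s²), with coefficients c_w(b) depending on the diagonal b of B
(`averageCoeff_eq_sum_esymmSq`).

Scaling A and B together by t multiplies the average by t^(2k), so t^(2w) c_w(tb) = t^(2k) c_w(b).
Letting t tend to 0 and comparing with B = 0 gives c_k = (-1)^k and c_w = 0 for w > k
(`expansionCoeff_of_le`). Thus convolving with q changes the coefficient of x^(d-k) only by a
combination of higher coefficients (`coeff_rectConv_eq`), with multipliers bounded while the roots
of q stay bounded.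

The mean condition bounds the roots of every p_i by dσ², so the multipliers are uniformly bounded
and induction on k shows that the coefficient of x^(d-k) after N factors is O(N^k)
(`exists_bound_of_increment_le`). Symmetrizing and scaling the roots by 1/N multiplies it by
N^(-2k), so it tends to 0 for k > 0, while the leading coefficient stays 1. Nothing about the roots
of the partial convolutions is used. -/

/-- The `m × d` rectangular diagonal matrix with diagonal entries `s`. -/
def rectDiagonal (m : ℕ) {d : ℕ} (s : Fin d → ℂ) : Matrix (Fin m) (Fin d) ℂ :=
  Matrix.of fun i j => if (i : ℕ) = (j : ℕ) then s j else 0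

/-- The Haar average of the `n`-th coefficient of the characteristic polynomial of
`(A + Q B Rᵀ)ᵀ (A + Q B Rᵀ)`. -/
def averageCoeff (n : ℕ) {m d : ℕ} (A B : Matrix (Fin m) (Fin d) ℂ) : ℂ :=
  ∫ Q, ∫ R, ((rotatedSum A B Q R).transpose * rotatedSum A B Q R).charpoly.coeff n
      ∂(haarO d) ∂(haarO m)

/-! ### Homogeneity, and continuity of the Haar averages -/

theorem continuous_charpoly_coeff {ι : Type*} [Fintype ι] [DecidableEq ι] (n : ℕ) :
    Continuous fun M : Matrix ι ι ℂ => M.charpoly.coeff n := by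
  have h : (fun M : Matrix ι ι ℂ => M.charpoly.coeff n) = fun M =>
      MvPolynomial.eval (fun p : ι × ι => M p.1 p.2)
        ((Matrix.charpoly.univ ℂ ι).coeff n) := by
    funext M
    exact (Matrix.charpoly.univ_coeff_eval₂Hom ι (RingHom.id ℂ) (fun p => M p.1 p.2) n).symm
  rw [h]
  refine (MvPolynomial.continuous_eval _).comp (continuous_pi fun p => ?_)
  exact continuous_id.matrix_elem p.1 p.2

/-- The coefficient is a homogeneous polynomial of degree k in the matrix entries; this also covers
t = 0. -/
theorem charpoly_coeff_smul {ι : Type*} [Fintype ι] [DecidableEq ι] (n k : ℕ)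
    (h : n + k = Fintype.card ι) (t : ℂ) (M : Matrix ι ι ℂ) :
    (t • M).charpoly.coeff n = t ^ k * M.charpoly.coeff n := by
  have h1 : ∀ M : Matrix ι ι ℂ, MvPolynomial.eval (fun p : ι × ι => M p.1 p.2)
      ((Matrix.charpoly.univ ℂ ι).coeff n) = M.charpoly.coeff n := fun M =>
    Matrix.charpoly.univ_coeff_eval₂Hom ι (RingHom.id ℂ) (fun p => M p.1 p.2) n
  rw [← h1, ← h1, MvPolynomial.eval_eq, MvPolynomial.eval_eq, Finset.mul_sum]
  refine Finset.sum_congr rfl fun e he => ?_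
  have hdeg := (Matrix.charpoly.univ_coeff_isHomogeneous (R := ℂ) ι n k h).degree_eq_sum_deg_support
    he
  rw [hdeg, ← Finset.prod_pow_eq_pow_sum]
  simp only [Matrix.smul_apply, smul_eq_mul, mul_pow, Finset.prod_mul_distrib]
  ring

theorem continuous_rotatedSum {m d : ℕ} :
    Continuous fun x : ((Matrix (Fin m) (Fin d) ℂ × Matrix (Fin m) (Fin d) ℂ) ×
      Matrix.orthogonalGroup (Fin m) ℝ) × Matrix.orthogonalGroup (Fin d) ℝ =>
      rotatedSum x.1.1.1 x.1.1.2 x.1.2 x.2 := by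
  unfold rotatedSum
  have h1 : Continuous fun x : ((Matrix (Fin m) (Fin d) ℂ × Matrix (Fin m) (Fin d) ℂ) ×
      Matrix.orthogonalGroup (Fin m) ℝ) × Matrix.orthogonalGroup (Fin d) ℝ =>
      (x.1.2 : Matrix (Fin m) (Fin m) ℝ).map Complex.ofReal :=
    (continuous_subtype_val.comp (continuous_snd.comp continuous_fst)).matrix_map
      Complex.continuous_ofReal
  have h2 : Continuous fun x : ((Matrix (Fin m) (Fin d) ℂ × Matrix (Fin m) (Fin d) ℂ) ×
      Matrix.orthogonalGroup (Fin m) ℝ) × Matrix.orthogonalGroup (Fin d) ℝ =>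
      (x.2 : Matrix (Fin d) (Fin d) ℝ).map Complex.ofReal :=
    (continuous_subtype_val.comp continuous_snd).matrix_map Complex.continuous_ofReal
  exact (continuous_fst.comp (continuous_fst.comp continuous_fst)).add
    ((h1.matrix_mul (continuous_snd.comp (continuous_fst.comp continuous_fst))).matrix_mul
      h2.matrix_transpose)

theorem continuous_integrand (n : ℕ) {m d : ℕ} :
    Continuous fun x : ((Matrix (Fin m) (Fin d) ℂ × Matrix (Fin m) (Fin d) ℂ) ×
      Matrix.orthogonalGroup (Fin m) ℝ) × Matrix.orthogonalGroup (Fin d) ℝ =>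
      ((rotatedSum x.1.1.1 x.1.1.2 x.1.2 x.2).transpose *
        rotatedSum x.1.1.1 x.1.1.2 x.1.2 x.2).charpoly.coeff n :=
  (continuous_charpoly_coeff n).comp
    (continuous_rotatedSum.matrix_transpose.matrix_mul continuous_rotatedSum)

/-- Continuity of an integral in its parameter is applied below with parameters in spaces of
matrices and orthogonal groups, which must be locally compact and first countable. -/
instance locallyCompactSpace_matrix (m d : ℕ) : LocallyCompactSpace (Matrix (Fin m) (Fin d) ℂ) :=
  inferInstanceAs (LocallyCompactSpace (Fin m → Fin d → ℂ))

instance firstCountable_matrix (m d : ℕ) : FirstCountableTopology (Matrix (Fin m) (Fin d) ℂ) :=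
  inferInstanceAs (FirstCountableTopology (Fin m → Fin d → ℂ))

instance firstCountable_matrix_real (m d : ℕ) :
    FirstCountableTopology (Matrix (Fin m) (Fin d) ℝ) :=
  inferInstanceAs (FirstCountableTopology (Fin m → Fin d → ℝ))

instance firstCountable_orthogonalGroup (n : ℕ) :
    FirstCountableTopology (Matrix.orthogonalGroup (Fin n) ℝ) :=
  TopologicalSpace.firstCountableTopology_induced _ _ Subtype.val

theorem continuous_inner (n : ℕ) {m d : ℕ} :
    Continuous fun x : (Matrix (Fin m) (Fin d) ℂ × Matrix (Fin m) (Fin d) ℂ) ×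
      Matrix.orthogonalGroup (Fin m) ℝ =>
      ∫ R, ((rotatedSum x.1.1 x.1.2 x.2 R).transpose *
        rotatedSum x.1.1 x.1.2 x.2 R).charpoly.coeff n ∂(haarO d) := by
  have h := continuous_parametric_integral_of_continuous (μ := haarO d) (s := Set.univ)
    (f := fun (x : (Matrix (Fin m) (Fin d) ℂ × Matrix (Fin m) (Fin d) ℂ) ×
      Matrix.orthogonalGroup (Fin m) ℝ) R => ((rotatedSum x.1.1 x.1.2 x.2 R).transpose *
        rotatedSum x.1.1 x.1.2 x.2 R).charpoly.coeff n)
    (continuous_integrand n) isCompact_univ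
  simpa using h

theorem continuous_averageCoeff (n : ℕ) {m d : ℕ} :
    Continuous fun x : Matrix (Fin m) (Fin d) ℂ × Matrix (Fin m) (Fin d) ℂ =>
      averageCoeff n x.1 x.2 := by
  have h := continuous_parametric_integral_of_continuous (μ := haarO m) (s := Set.univ)
    (f := fun (x : Matrix (Fin m) (Fin d) ℂ × Matrix (Fin m) (Fin d) ℂ) Q =>
      ∫ R, ((rotatedSum x.1 x.2 Q R).transpose *
        rotatedSum x.1 x.2 Q R).charpoly.coeff n ∂(haarO d))
    (continuous_inner n) isCompact_univ
  simpa [averageCoeff] using h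

/-! ### Orthogonal invariance -/

theorem map_ofReal_mul {l : ℕ} (S T : Matrix (Fin l) (Fin l) ℝ) :
    (S * T).map Complex.ofReal = S.map Complex.ofReal * T.map Complex.ofReal :=
  Matrix.map_mul (f := Complex.ofRealHom)

theorem transpose_mul_self_map {l : ℕ} (S : Matrix.orthogonalGroup (Fin l) ℝ) :
    ((S : Matrix (Fin l) (Fin l) ℝ).map Complex.ofReal).transpose *
      (S : Matrix (Fin l) (Fin l) ℝ).map Complex.ofReal = 1 := by
  rw [← Matrix.transpose_map, ← map_ofReal_mul,
    (Matrix.mem_orthogonalGroup_iff' (Fin l) ℝ).mp S.2]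
  exact Matrix.map_one (f := Complex.ofReal) (by simp) (by simp)

/-- The rotated sum becomes S M Tᵀ with S and T orthogonal, so its Gram matrix is only conjugated by
T. -/
theorem charpoly_rotatedSum_mul {m d : ℕ} (A B : Matrix (Fin m) (Fin d) ℂ)
    (Q₀ Q : Matrix.orthogonalGroup (Fin m) ℝ) (R₀ R : Matrix.orthogonalGroup (Fin d) ℝ) :
    ((rotatedSum ((Q₀ : Matrix (Fin m) (Fin m) ℝ).map Complex.ofReal * A *
        ((R₀ : Matrix (Fin d) (Fin d) ℝ).map Complex.ofReal).transpose) B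
          (Q₀ * Q) (R₀ * R)).transpose *
      rotatedSum ((Q₀ : Matrix (Fin m) (Fin m) ℝ).map Complex.ofReal * A *
        ((R₀ : Matrix (Fin d) (Fin d) ℝ).map Complex.ofReal).transpose) B
          (Q₀ * Q) (R₀ * R)).charpoly =
    ((rotatedSum A B Q R).transpose * rotatedSum A B Q R).charpoly := by
  have h : rotatedSum ((Q₀ : Matrix (Fin m) (Fin m) ℝ).map Complex.ofReal * A *
        ((R₀ : Matrix (Fin d) (Fin d) ℝ).map Complex.ofReal).transpose) B (Q₀ * Q) (R₀ * R) =
      (Q₀ : Matrix (Fin m) (Fin m) ℝ).map Complex.ofReal * rotatedSum A B Q R *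
        ((R₀ : Matrix (Fin d) (Fin d) ℝ).map Complex.ofReal).transpose := by
    simp only [rotatedSum, Submonoid.coe_mul, map_ofReal_mul, Matrix.transpose_mul,
      Matrix.mul_add, Matrix.add_mul, Matrix.mul_assoc]
  rw [h]
  set M := rotatedSum A B Q R
  set S := (Q₀ : Matrix (Fin m) (Fin m) ℝ).map Complex.ofReal with hS
  set T := (R₀ : Matrix (Fin d) (Fin d) ℝ).map Complex.ofReal with hT
  have e : (S * M * T.transpose).transpose * (S * M * T.transpose) =
      T * (M.transpose * M * T.transpose) := by
    simp only [Matrix.transpose_mul, Matrix.transpose_transpose, Matrix.mul_assoc]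
    rw [← Matrix.mul_assoc S.transpose, transpose_mul_self_map, Matrix.one_mul]
  rw [e, Matrix.charpoly_mul_comm, Matrix.mul_assoc, transpose_mul_self_map, Matrix.mul_one]

theorem averageCoeff_orthogonal_mul (n : ℕ) {m d : ℕ} (A B : Matrix (Fin m) (Fin d) ℂ)
    (Q₀ : Matrix.orthogonalGroup (Fin m) ℝ) (R₀ : Matrix.orthogonalGroup (Fin d) ℝ) :
    averageCoeff n ((Q₀ : Matrix (Fin m) (Fin m) ℝ).map Complex.ofReal * A *
        ((R₀ : Matrix (Fin d) (Fin d) ℝ).map Complex.ofReal).transpose) B =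
      averageCoeff n A B := by
  unfold averageCoeff
  rw [← integral_mul_left_eq_self _ Q₀]
  congr 1
  funext Q
  rw [← integral_mul_left_eq_self _ R₀]
  congr 1
  funext R
  rw [charpoly_rotatedSum_mul]

/-- The orthogonal matrix of a permutation. -/
def permOrthogonal {l : ℕ} (π : Equiv.Perm (Fin l)) : Matrix.orthogonalGroup (Fin l) ℝ :=
  ⟨π.permMatrix ℝ, by
    rw [Matrix.mem_orthogonalGroup_iff, Matrix.transpose_permMatrix, ← Matrix.permMatrix_mul]
    simp⟩

/-- The reflection negating the `i`-th coordinate. -/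
def reflection {l : ℕ} (i : Fin l) : Matrix.orthogonalGroup (Fin l) ℝ :=
  ⟨Matrix.diagonal fun j => if j = i then -1 else 1, by
    rw [Matrix.mem_orthogonalGroup_iff, Matrix.diagonal_transpose, Matrix.diagonal_mul_diagonal,
      ← Matrix.diagonal_one]
    congr 1
    funext j
    split_ifs <;> norm_num⟩

/-- Right multiplication by a reflection negates one column of the diagonal matrix, which the
average does not see. -/
theorem averageCoeff_update_neg (n : ℕ) {m d : ℕ} (s : Fin d → ℂ)
    (B : Matrix (Fin m) (Fin d) ℂ) (i : Fin d) (t : ℂ) :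
    averageCoeff n (rectDiagonal m (Function.update s i (-t))) B =
      averageCoeff n (rectDiagonal m (Function.update s i t)) B := by
  rw [← averageCoeff_orthogonal_mul n (rectDiagonal m (Function.update s i t)) B 1
    (reflection i)]
  congr 1
  have h1 : ((1 : Matrix.orthogonalGroup (Fin m) ℝ) : Matrix (Fin m) (Fin m) ℝ).map
      Complex.ofReal = 1 := Matrix.map_one (f := Complex.ofReal) (by simp) (by simp)
  have h2 : ((reflection i : Matrix.orthogonalGroup (Fin d) ℝ) : Matrix (Fin d) (Fin d) ℝ).map
      Complex.ofReal = Matrix.diagonal fun j => if j = i then (-1 : ℂ) else 1 := by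
    ext a b
    by_cases hab : a = b
    · subst hab
      simp only [reflection, Matrix.map_apply, Matrix.diagonal_apply_eq]
      split_ifs <;> simp
    · simp [reflection, hab]
  rw [h1, h2, Matrix.one_mul, Matrix.diagonal_transpose]
  ext a b
  rw [Matrix.mul_diagonal]
  by_cases hb : b = i
  · subst hb
    by_cases hab : (a : ℕ) = b <;> simp [rectDiagonal, hab]
  · simp [rectDiagonal, hb]

/-- A permutation of `Fin d` extended to `Fin m`, fixing the indices from `d` on. -/
theorem exists_perm_castLE {m d : ℕ} (hdm : d ≤ m) (π : Equiv.Perm (Fin d)) :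
    ∃ ρ : Equiv.Perm (Fin m), ∀ j, ρ (Fin.castLE hdm j) = Fin.castLE hdm (π j) := by
  refine ⟨π.viaFintypeEmbedding (Fin.castLEEmb hdm), fun j => ?_⟩
  exact Equiv.Perm.viaFintypeEmbedding_apply_image π (Fin.castLEEmb hdm) j

/-- Permuting the diagonal amounts to permuting columns by `π` and rows by an extension of `π` to
all m row indices. -/
theorem averageCoeff_comp_perm (n : ℕ) {m d : ℕ} (hdm : d ≤ m) (s : Fin d → ℂ)
    (B : Matrix (Fin m) (Fin d) ℂ) (π : Equiv.Perm (Fin d)) :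
    averageCoeff n (rectDiagonal m (s ∘ π)) B = averageCoeff n (rectDiagonal m s) B := by
  obtain ⟨ρ, hρ⟩ := exists_perm_castLE hdm π
  rw [← averageCoeff_orthogonal_mul n (rectDiagonal m s) B (permOrthogonal ρ)
    (permOrthogonal π)]
  congr 1
  have h : ∀ {l : ℕ} (τ : Equiv.Perm (Fin l)),
      ((permOrthogonal τ : Matrix.orthogonalGroup (Fin l) ℝ) : Matrix (Fin l) (Fin l) ℝ).map
        Complex.ofReal = τ.permMatrix ℂ := by
    intro l τ
    ext a b
    simp only [permOrthogonal, Matrix.map_apply, Equiv.Perm.permMatrix, PEquiv.toMatrix_apply]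
    split_ifs <;> simp
  rw [h, h, Matrix.transpose_permMatrix]
  ext a b
  rw [Equiv.Perm.permMatrix, Equiv.Perm.permMatrix, PEquiv.mul_toMatrix_toPEquiv,
    PEquiv.toMatrix_toPEquiv_mul]
  have hiff : (a : ℕ) = b ↔ ((ρ a : Fin m) : ℕ) = (π b : Fin d) := by
    have e1 : (a : ℕ) = b ↔ a = Fin.castLE hdm b := by simp [Fin.ext_iff]
    have e2 : ((ρ a : Fin m) : ℕ) = (π b : Fin d) ↔ ρ a = Fin.castLE hdm (π b) := by
      simp [Fin.ext_iff]
    rw [e1, e2, ← hρ, ρ.injective.eq_iff]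
  simp only [rectDiagonal, Matrix.submatrix_apply, Matrix.of_apply, id, Function.comp_apply, hiff]
  rfl

/-! ### Dependence on a single diagonal entry -/

theorem det_updateRow_updateRow_add_smul {ι R : Type*} [Fintype ι] [DecidableEq ι] [CommRing R]
    (H : Matrix ι ι R) {a b : ι} (hab : a ≠ b) (u v : ι → R) :
    ∃ f₁ f₂ : R, ∀ c : R,
      ((H.updateRow a (H a + c • u)).updateRow b (H b + c • v)).det =
        H.det + c * f₁ + c ^ 2 * f₂ := by
  refine ⟨(H.updateRow a u).det + (H.updateRow b v).det,
    ((H.updateRow a u).updateRow b v).det, fun c => ?_⟩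
  have h1 : ∀ w, (H.updateRow a w).updateRow b (H b) = H.updateRow a w := fun w => by
    have := Matrix.updateRow_eq_self (H.updateRow a w) b
    rwa [Matrix.updateRow_ne hab.symm] at this
  rw [Matrix.det_updateRow_add, Matrix.det_updateRow_smul, h1, Matrix.det_updateRow_add,
    Matrix.det_updateRow_smul, Matrix.updateRow_eq_self, Matrix.updateRow_comm _ hab,
    Matrix.det_updateRow_add, Matrix.det_updateRow_smul]
  have h2 : (H.updateRow b v).updateRow a (H a) = H.updateRow b v := by
    have := Matrix.updateRow_eq_self (H.updateRow b v) a
    rwa [Matrix.updateRow_ne hab] at this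
  rw [h2, Matrix.updateRow_comm _ hab.symm]
  ring

/-- By the Schur complement, the characteristic polynomial of NᵀN is the determinant of the block
matrix with rows (X·1, Nᵀ) and (N, 1). This is linear in N entrywise, and a single entry of N occurs
in just two rows, so the determinant has degree at most 2 in it. -/
theorem charpoly_transpose_mul_self_add_single {m d : ℕ} (M : Matrix (Fin m) (Fin d) ℂ)
    (p : Fin m) (q : Fin d) :
    ∃ f₀ f₁ f₂ : ℂ[X], ∀ t : ℂ,
      ((M + Matrix.single p q t).transpose * (M + Matrix.single p q t)).charpoly =
        f₀ + C t * f₁ + C t ^ 2 * f₂ := by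
  have hblock : ∀ N : Matrix (Fin m) (Fin d) ℂ, (N.transpose * N).charpoly =
      (Matrix.fromBlocks (Matrix.scalar (Fin d) (X : ℂ[X])) (N.transpose.map C) (N.map C)
        (1 : Matrix (Fin m) (Fin m) ℂ[X])).det := by
    intro N
    rw [Matrix.det_fromBlocks_one₂₂, Matrix.charpoly, Matrix.charmatrix, ← Matrix.map_mul]
    rfl
  set H := Matrix.fromBlocks (Matrix.scalar (Fin d) (X : ℂ[X])) (M.transpose.map C) (M.map C)
        (1 : Matrix (Fin m) (Fin m) ℂ[X]) with hH
  obtain ⟨f₁, f₂, hf⟩ := det_updateRow_updateRow_add_smul H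
    (a := Sum.inl q) (b := Sum.inr p) (by simp) (Pi.single (Sum.inr p) 1)
    (Pi.single (Sum.inl q) 1)
  refine ⟨H.det, f₁, f₂, fun t => ?_⟩
  rw [hblock, ← hf (C t)]
  congr 1
  ext1 i j
  rcases i with i | i <;> rcases j with j | j
  · by_cases hi : i = q
    · subst hi
      simp [Matrix.updateRow_apply, hH]
    · simp [Matrix.updateRow_apply, hH, hi]
  · by_cases hi : i = q
    · subst hi
      by_cases hj : j = p
      · subst hj
        simp [Matrix.updateRow_apply, hH]
      · simp [Matrix.updateRow_apply, hH, hj, Ne.symm hj]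
    · simp [Matrix.updateRow_apply, hH, hi, Ne.symm hi]
  · by_cases hi : i = p
    · subst hi
      by_cases hj : j = q
      · subst hj
        simp [Matrix.updateRow_apply, hH]
      · simp [Matrix.updateRow_apply, hH, hj, Ne.symm hj]
    · simp [Matrix.updateRow_apply, hH, hi, Ne.symm hi]
  · by_cases hi : i = p
    · subst hi
      simp [Matrix.updateRow_apply, hH]
    · simp [Matrix.updateRow_apply, hH, hi]

theorem rectDiagonal_update {m d : ℕ} (hdm : d ≤ m) (s : Fin d → ℂ) (i : Fin d) (t : ℂ) :
    rectDiagonal m (Function.update s i t) =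
      rectDiagonal m (Function.update s i 0) + Matrix.single (Fin.castLE hdm i) i t := by
  ext a b
  by_cases hb : b = i
  · subst hb
    by_cases ha : a = Fin.castLE hdm b
    · subst ha
      simp [rectDiagonal]
    · have : (a : ℕ) ≠ b := fun h => ha (Fin.ext h)
      simp [rectDiagonal, this, Ne.symm ha]
  · simp [rectDiagonal, hb, Ne.symm hb]

/-- Lagrange interpolation of a quadratic at 0, 1, -1. It replaces the unspecified polynomials `f₀`,
`f₁`, `f₂`, which depend on `Q` and `R`, by values whose integrability is clear. -/
theorem charpoly_rotatedSum_update_interpolation (n : ℕ) {m d : ℕ} (hdm : d ≤ m) (s : Fin d → ℂ)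
    (B : Matrix (Fin m) (Fin d) ℂ) (i : Fin d) (t : ℂ) (Q : Matrix.orthogonalGroup (Fin m) ℝ)
    (R : Matrix.orthogonalGroup (Fin d) ℝ) :
    ((rotatedSum (rectDiagonal m (Function.update s i t)) B Q R).transpose *
        rotatedSum (rectDiagonal m (Function.update s i t)) B Q R).charpoly.coeff n =
      (1 - t ^ 2) * ((rotatedSum (rectDiagonal m (Function.update s i 0)) B Q R).transpose *
        rotatedSum (rectDiagonal m (Function.update s i 0)) B Q R).charpoly.coeff n +
      (t ^ 2 + t) / 2 * ((rotatedSum (rectDiagonal m (Function.update s i 1)) B Q R).transpose *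
        rotatedSum (rectDiagonal m (Function.update s i 1)) B Q R).charpoly.coeff n +
      (t ^ 2 - t) / 2 * ((rotatedSum (rectDiagonal m (Function.update s i (-1))) B Q R).transpose *
        rotatedSum (rectDiagonal m (Function.update s i (-1))) B Q R).charpoly.coeff n := by
  obtain ⟨f₀, f₁, f₂, hf⟩ := charpoly_transpose_mul_self_add_single
    (rotatedSum (rectDiagonal m (Function.update s i 0)) B Q R) (Fin.castLE hdm i) i
  have h : ∀ z : ℂ, ((rotatedSum (rectDiagonal m (Function.update s i z)) B Q R).transpose *
        rotatedSum (rectDiagonal m (Function.update s i z)) B Q R).charpoly.coeff n =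
      f₀.coeff n + z * f₁.coeff n + z ^ 2 * f₂.coeff n := by
    intro z
    have e : rotatedSum (rectDiagonal m (Function.update s i z)) B Q R =
        rotatedSum (rectDiagonal m (Function.update s i 0)) B Q R +
          Matrix.single (Fin.castLE hdm i) i z := by
      rw [rotatedSum, rotatedSum, rectDiagonal_update hdm s i z]
      abel
    rw [e, hf z, ← C_pow, coeff_add, coeff_add, coeff_C_mul, coeff_C_mul]
  rw [h t, h 0, h 1, h (-1)]
  ring

theorem integrable_of_continuous_orthogonalGroup {l : ℕ}
    {f : Matrix.orthogonalGroup (Fin l) ℝ → ℂ} (hf : Continuous f) : Integrable f (haarO l) :=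
  hf.integrable_of_hasCompactSupport (HasCompactSupport.of_compactSpace f)

theorem integral_add_three {α : Type*} [MeasurableSpace α] {μ : Measure α} {f g h : α → ℂ}
    (hf : Integrable f μ) (hg : Integrable g μ) (hh : Integrable h μ) (a b c : ℂ) :
    ∫ x, (a * f x + b * g x + c * h x) ∂μ =
      a * ∫ x, f x ∂μ + b * ∫ x, g x ∂μ + c * ∫ x, h x ∂μ := by
  have h1 := integral_add ((hf.const_mul a).add (hg.const_mul b)) (hh.const_mul c)
  have h2 := integral_add (hf.const_mul a) (hg.const_mul b)
  simp only [Pi.add_apply, integral_const_mul] at h1 h2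
  rw [h1, h2]

theorem averageCoeff_update_interpolation (n : ℕ) {m d : ℕ} (hdm : d ≤ m) (s : Fin d → ℂ)
    (B : Matrix (Fin m) (Fin d) ℂ) (i : Fin d) (t : ℂ) :
    averageCoeff n (rectDiagonal m (Function.update s i t)) B =
      (1 - t ^ 2) * averageCoeff n (rectDiagonal m (Function.update s i 0)) B +
      (t ^ 2 + t) / 2 * averageCoeff n (rectDiagonal m (Function.update s i 1)) B +
      (t ^ 2 - t) / 2 * averageCoeff n (rectDiagonal m (Function.update s i (-1))) B := by
  have hR : ∀ (A : Matrix (Fin m) (Fin d) ℂ) (Q : Matrix.orthogonalGroup (Fin m) ℝ),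
      Integrable (fun R => ((rotatedSum A B Q R).transpose *
        rotatedSum A B Q R).charpoly.coeff n) (haarO d) := by
    intro A Q
    have h : Continuous fun R : Matrix.orthogonalGroup (Fin d) ℝ => (((A, B), Q), R) :=
      Continuous.prodMk_right _
    have h' := (continuous_integrand n).comp h
    exact integrable_of_continuous_orthogonalGroup h'
  have hQ : ∀ A : Matrix (Fin m) (Fin d) ℂ,
      Integrable (fun Q => ∫ R, ((rotatedSum A B Q R).transpose *
        rotatedSum A B Q R).charpoly.coeff n ∂(haarO d)) (haarO m) := by
    intro A
    have h : Continuous fun Q : Matrix.orthogonalGroup (Fin m) ℝ => ((A, B), Q) :=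
      Continuous.prodMk_right _
    have h' := (continuous_inner n).comp h
    exact integrable_of_continuous_orthogonalGroup h'
  unfold averageCoeff
  refine Eq.trans (integral_congr_ae (.of_forall fun Q => ?_))
    (integral_add_three (hQ _) (hQ _) (hQ _) _ _ _)
  refine Eq.trans (integral_congr_ae (.of_forall fun R => ?_))
    (integral_add_three (hR _ Q) (hR _ Q) (hR _ Q) _ _ _)
  exact charpoly_rotatedSum_update_interpolation n hdm s B i t Q R

/-- The values at 1 and -1 agree by reflection invariance, so the linear term of the interpolation
drops out. -/
theorem averageCoeff_update (n : ℕ) {m d : ℕ} (hdm : d ≤ m) (s : Fin d → ℂ)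
    (B : Matrix (Fin m) (Fin d) ℂ) (i : Fin d) (t : ℂ) :
    averageCoeff n (rectDiagonal m (Function.update s i t)) B =
      averageCoeff n (rectDiagonal m (Function.update s i 0)) B +
      t ^ 2 * (averageCoeff n (rectDiagonal m (Function.update s i 1)) B -
        averageCoeff n (rectDiagonal m (Function.update s i 0)) B) := by
  rw [averageCoeff_update_interpolation n hdm s B i t, averageCoeff_update_neg n s B i 1]
  ring

/-! ### Expansion in elementary symmetric functions -/

/-- A function that is affine in the square of each variable is a combination of the
square-free monomials in the squares, with coefficients given by Möbius inversion. -/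
theorem eq_sum_of_update_eq {ι : Type*} [DecidableEq ι] (P : (ι → ℂ) → ℂ)
    (hP : ∀ s i t, P (Function.update s i t) = P (Function.update s i 0) +
      t ^ 2 * (P (Function.update s i 1) - P (Function.update s i 0)))
    (s u : ι → ℂ) (U : Finset ι) :
    P (U.piecewise s u) = ∑ W ∈ U.powerset, (∏ i ∈ W, s i ^ 2) *
      ∑ T ∈ W.powerset, (-1) ^ (W.card + T.card) * P (T.piecewise 1 (U.piecewise 0 u)) := by
  induction U using Finset.induction_on generalizing u with
  | empty => simp
  | insert i U hi ih =>
    rw [Finset.piecewise_insert, hP, Finset.sum_powerset_insert hi]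
    -- The new variable lies outside `U`, so it can be moved into the background `u`, over which the
    -- induction hypothesis is general.
    have e : ∀ z : ℂ, Function.update (U.piecewise s u) i z =
        U.piecewise s (Function.update u i z) := fun z => by
      rw [Finset.update_piecewise_of_notMem _ _ _ hi]
    rw [e, e, ih, ih, ← Finset.sum_sub_distrib, Finset.mul_sum]
    congr 1
    · refine Finset.sum_congr rfl fun W hW => ?_
      congr 1
      refine Finset.sum_congr rfl fun T hT => ?_
      congr 3
      ext j
      by_cases hj : j = i
      · subst hj; simp [hi]
      · by_cases hU : j ∈ U <;> simp [hj, hU]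
    · refine Finset.sum_congr rfl fun W hW => ?_
      have hWU := Finset.mem_powerset.mp hW
      have hiW : i ∉ W := fun h => hi (hWU h)
      rw [Finset.prod_insert hiW, Finset.sum_powerset_insert hiW, ← mul_sub, ← mul_assoc,
        ← Finset.sum_sub_distrib, ← Finset.sum_add_distrib]
      congr 1
      refine Finset.sum_congr rfl fun T hT => ?_
      have hTW := Finset.mem_powerset.mp hT
      have hiT : i ∉ T := fun h => hiW (hTW h)
      have e0 : U.piecewise (0 : ι → ℂ) (Function.update u i 0) =
          (insert i U).piecewise (0 : ι → ℂ) u := by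
        ext j
        by_cases hj : j = i
        · subst hj; simp [hi]
        · by_cases hU : j ∈ U <;> simp [hj, hU]
      have e1 : T.piecewise (1 : ι → ℂ) (U.piecewise 0 (Function.update u i 1)) =
          (insert i T).piecewise (1 : ι → ℂ) ((insert i U).piecewise (0 : ι → ℂ) u) := by
        ext j
        by_cases hj : j = i
        · subst hj; simp [hi, hiT]
        · by_cases hU : j ∈ U <;> by_cases hTj : j ∈ T <;> simp [hj, hU, hTj]
      rw [e0, e1, Finset.card_insert_of_notMem hiW, Finset.card_insert_of_notMem hiT]
      ring

/-- The first `j` elements of `Fin d`. -/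
def initialIndices (d j : ℕ) : Finset (Fin d) := Finset.univ.filter fun i => (i : ℕ) < j

theorem card_initialIndices {d j : ℕ} (hj : j ≤ d) : (initialIndices d j).card = j := by
  rw [initialIndices, Fin.card_filter_val_lt, min_eq_right hj]

/-- The `w`-th elementary symmetric function of the squares of `s`. -/
def esymmSq {d : ℕ} (w : ℕ) (s : Fin d → ℂ) : ℂ :=
  ∑ W ∈ Finset.powersetCard w Finset.univ, ∏ i ∈ W, s i ^ 2

/-- A bijection between sets of equal size extends to a permutation of the finite index set. -/
theorem apply_piecewise_eq_of_symmetric {d : ℕ} (P : (Fin d → ℂ) → ℂ)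
    (hP : ∀ s (π : Equiv.Perm (Fin d)), P (s ∘ π) = P s) {S T : Finset (Fin d)}
    (h : S.card = T.card) : P (S.piecewise 1 0) = P (T.piecewise 1 0) := by
  have hc : Fintype.card {x // x ∈ S} = Fintype.card {x // x ∈ T} := by simpa using h
  let e := Fintype.equivOfCardEq hc
  rw [← hP (T.piecewise 1 0) e.extendSubtype]
  congr 1
  funext x
  by_cases hx : x ∈ S
  · have := e.extendSubtype_mem x hx
    simp [hx, this]
  · have := e.extendSubtype_not_mem x hx
    simp [hx, this]

/-- The coefficient of `esymmSq w s` in the expansion of the averaged `n`-th coefficient for the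
pair of diagonals `s`, `b`. -/
def expansionCoeff (m : ℕ) {d : ℕ} (n w : ℕ) (b : Fin d → ℂ) : ℂ :=
  ∑ j ∈ Finset.range (w + 1), w.choose j • ((-1) ^ (w + j) *
    averageCoeff n (rectDiagonal m ((initialIndices d j).piecewise 1 0)) (rectDiagonal m b))

theorem averageCoeff_eq_sum_esymmSq (n : ℕ) {m d : ℕ} (hdm : d ≤ m) (s b : Fin d → ℂ) :
    averageCoeff n (rectDiagonal m s) (rectDiagonal m b) =
      ∑ w ∈ Finset.range (d + 1), esymmSq w s * expansionCoeff m n w b := by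
  have h := eq_sum_of_update_eq
    (fun s => averageCoeff n (rectDiagonal m s) (rectDiagonal m b))
    (fun s i t => averageCoeff_update n hdm s _ i t) s 0 Finset.univ
  simp only [Finset.piecewise_univ] at h
  rw [h, Finset.sum_powerset, Finset.card_univ, Fintype.card_fin]
  refine Finset.sum_congr rfl fun w _ => ?_
  rw [esymmSq, Finset.sum_mul]
  refine Finset.sum_congr rfl fun W hW => ?_
  have hWc := (Finset.mem_powersetCard.mp hW).2
  congr 1
  -- By symmetry each Möbius summand depends on `T` only through its cardinality, so the initial
  -- segment of that size can stand for `T`.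
  rw [expansionCoeff, ← hWc, ← Finset.sum_powerset_apply_card (fun j => (-1) ^ (W.card + j) *
    averageCoeff n (rectDiagonal m ((initialIndices d j).piecewise 1 0)) (rectDiagonal m b))]
  refine Finset.sum_congr rfl fun T _ => ?_
  congr 1
  refine apply_piecewise_eq_of_symmetric
    (fun s => averageCoeff n (rectDiagonal m s) (rectDiagonal m b))
    (fun s π => averageCoeff_comp_perm n hdm s _ π) ?_
  rw [card_initialIndices]
  simpa using T.card_le_univ

theorem esymmSq_initialIndices {d j : ℕ} (hj : j ≤ d) (w : ℕ) :
    esymmSq w ((initialIndices d j).piecewise 1 0) = (j.choose w : ℂ) := by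
  rw [esymmSq]
  have h : ∀ W : Finset (Fin d), ∏ i ∈ W,
      ((initialIndices d j).piecewise (1 : Fin d → ℂ) 0 i) ^ 2 =
      if W ⊆ initialIndices d j then 1 else 0 := by
    intro W
    split_ifs with hW
    · exact Finset.prod_eq_one fun i hi => by simp [hW hi]
    · obtain ⟨i, hi, hi'⟩ := Finset.not_subset.mp hW
      exact Finset.prod_eq_zero hi (by simp [hi'])
  simp only [h]
  rw [Finset.sum_boole]
  have e : (Finset.powersetCard w Finset.univ).filter (fun W => W ⊆ initialIndices d j) =
      Finset.powersetCard w (initialIndices d j) := by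
    ext W
    simp [Finset.mem_powersetCard, and_comm]
  rw [e, Finset.card_powersetCard, card_initialIndices hj]

/-- Evaluating at vectors of w ones followed by zeros gives a unitriangular system of binomial
coefficients, so the expansion coefficients are unique. -/
theorem eq_of_sum_esymmSq_eq {d : ℕ} (x y : ℕ → ℂ)
    (h : ∀ s : Fin d → ℂ, ∑ w ∈ Finset.range (d + 1), esymmSq w s * x w =
      ∑ w ∈ Finset.range (d + 1), esymmSq w s * y w) : ∀ w ≤ d, x w = y w := by
  intro w
  induction w using Nat.strong_induction_on with
  | _ w ih =>
    intro hw
    have h1 := h ((initialIndices d w).piecewise 1 0)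
    simp only [esymmSq_initialIndices hw] at h1
    have h2 : ∀ z : ℕ → ℂ, ∑ v ∈ Finset.range (d + 1), (w.choose v : ℂ) * z v =
        ∑ v ∈ Finset.range w, (w.choose v : ℂ) * z v + z w := by
      intro z
      rw [← Finset.sum_subset (s₁ := Finset.range (w + 1))
        (Finset.range_subset_range.mpr (by omega)), Finset.sum_range_succ]
      · simp
      · intro v _ hv
        rw [Nat.choose_eq_zero_of_lt (by simpa using hv)]
        simp
    rw [h2, h2, Finset.sum_congr rfl fun v hv => by
      rw [ih v (Finset.mem_range.mp hv) (by have := Finset.mem_range.mp hv; omega)]] at h1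
    exact add_left_cancel h1

/-! ### Scaling and triangularity of the expansion -/

theorem esymmSq_smul {d : ℕ} (w : ℕ) (t : ℂ) (s : Fin d → ℂ) :
    esymmSq w (t • s) = t ^ (2 * w) * esymmSq w s := by
  rw [esymmSq, esymmSq, Finset.mul_sum]
  refine Finset.sum_congr rfl fun W hW => ?_
  have hWc := (Finset.mem_powersetCard.mp hW).2
  simp only [Pi.smul_apply, smul_eq_mul, mul_pow, Finset.prod_mul_distrib, Finset.prod_const, hWc,
    pow_mul]

theorem rectDiagonal_smul {m d : ℕ} (t : ℂ) (s : Fin d → ℂ) :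
    rectDiagonal m (t • s) = t • rectDiagonal m s := by
  ext a b
  simp [rectDiagonal]

theorem rectDiagonal_zero {m d : ℕ} : rectDiagonal m (0 : Fin d → ℂ) = 0 := by
  ext a b
  simp [rectDiagonal]

theorem averageCoeff_smul {m d n k : ℕ} (h : n + k = d) (t : ℂ)
    (A B : Matrix (Fin m) (Fin d) ℂ) :
    averageCoeff n (t • A) (t • B) = t ^ (2 * k) * averageCoeff n A B := by
  unfold averageCoeff
  rw [← integral_const_mul]
  congr 1
  funext Q
  rw [← integral_const_mul]
  congr 1
  funext R
  have e : rotatedSum (t • A) (t • B) Q R = t • rotatedSum A B Q R := by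
    simp [rotatedSum]
  rw [e, Matrix.transpose_smul, Matrix.smul_mul, Matrix.mul_smul, smul_smul,
    charpoly_coeff_smul n k (by simpa using h), pow_mul, sq]

theorem charpoly_rectDiagonal {m d : ℕ} (hdm : d ≤ m) (s : Fin d → ℂ) :
    ((rectDiagonal m s).transpose * rectDiagonal m s).charpoly = ∏ j, (X - C (s j ^ 2)) := by
  have hdiag : (rectDiagonal m s).transpose * rectDiagonal m s =
      Matrix.diagonal fun j => s j ^ 2 := by
    ext i j
    rw [Matrix.mul_apply, Finset.sum_eq_single (Fin.castLE hdm i)]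
    · by_cases h : i = j
      · subst h
        simp [rectDiagonal, sq]
      · have h' : (i : ℕ) ≠ (j : ℕ) := fun e => h (Fin.ext e)
        simp [rectDiagonal, h, h']
    · intro k _ hk
      have h' : (k : ℕ) ≠ (i : ℕ) := fun e => hk (Fin.ext (by simpa using e))
      simp [rectDiagonal, h']
    · simp
  rw [hdiag, Matrix.charpoly_diagonal]

theorem coeff_prod_X_sub_C_sq {d n k : ℕ} (h : n + k = d) (s : Fin d → ℂ) :
    (∏ j, (X - C (s j ^ 2))).coeff n = (-1) ^ k * esymmSq k s := by
  have h1 := Multiset.prod_X_sub_C_coeff (Finset.univ.val.map fun j => s j ^ 2) (k := n)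
    (by simp; omega)
  rw [Multiset.map_map] at h1
  have hk : Multiset.card (Finset.univ.val.map fun j : Fin d => s j ^ 2) - n = k := by
    simp; omega
  rw [hk, Finset.esymm_map_val] at h1
  exact h1

theorem averageCoeff_zero_right {m d : ℕ} (n : ℕ) (A : Matrix (Fin m) (Fin d) ℂ) :
    averageCoeff n A 0 = (A.transpose * A).charpoly.coeff n := by
  simp [averageCoeff, rotatedSum]

theorem continuous_expansionCoeff (m : ℕ) {d : ℕ} (n w : ℕ) :
    Continuous fun b : Fin d → ℂ => expansionCoeff m n w b := by
  have h : Continuous fun b : Fin d → ℂ => rectDiagonal m b := by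
    refine continuous_matrix fun i j => ?_
    simp only [rectDiagonal, Matrix.of_apply]
    split_ifs
    · exact continuous_apply j
    · exact continuous_const
  have h' : ∀ A : Matrix (Fin m) (Fin d) ℂ,
      Continuous fun b : Fin d → ℂ => averageCoeff n A (rectDiagonal m b) := by
    intro A
    have hA : Continuous fun b : Fin d → ℂ => (A, rectDiagonal m b) := continuous_const.prodMk h
    have hcomp := (continuous_averageCoeff n).comp hA
    exact hcomp
  unfold expansionCoeff
  refine continuous_finsetSum _ fun j _ => ?_
  exact (continuous_const.mul (h' _)).const_smul _

/-- Scale both diagonals by `t` and compare the two expansions in `s`, using uniqueness of the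
coefficients. -/
theorem expansionCoeff_smul {m d n k : ℕ} (hdm : d ≤ m) (h : n + k = d) (b : Fin d → ℂ) {t : ℂ}
    {w : ℕ} (hw : w ≤ d) :
    t ^ (2 * w) * expansionCoeff m n w (t • b) = t ^ (2 * k) * expansionCoeff m n w b := by
  refine eq_of_sum_esymmSq_eq (d := d) (fun w => t ^ (2 * w) * expansionCoeff m n w (t • b))
    (fun w => t ^ (2 * k) * expansionCoeff m n w b) (fun s => ?_) w hw
  have h1 := averageCoeff_smul h t (rectDiagonal m s) (rectDiagonal m b)
  rw [← rectDiagonal_smul, ← rectDiagonal_smul, averageCoeff_eq_sum_esymmSq n hdm,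
    averageCoeff_eq_sum_esymmSq n hdm, Finset.mul_sum] at h1
  refine Eq.trans (Finset.sum_congr rfl fun w _ => ?_)
    (h1.trans (Finset.sum_congr rfl fun w _ => ?_))
  · rw [esymmSq_smul]; ring
  · ring

/-- For B = 0 the integrand is constant: it is the n-th coefficient of ∏(X - s_j²), namely (-1)^k
e_k(s²). -/
theorem expansionCoeff_zero {m d n k : ℕ} (hdm : d ≤ m) (h : n + k = d) {w : ℕ} (hw : w ≤ d) :
    expansionCoeff m n w (0 : Fin d → ℂ) = if w = k then (-1) ^ k else 0 := by
  refine eq_of_sum_esymmSq_eq (d := d) (fun w => expansionCoeff m n w (0 : Fin d → ℂ))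
    (fun w => if w = k then (-1) ^ k else 0) (fun s => ?_) w hw
  rw [← averageCoeff_eq_sum_esymmSq n hdm, rectDiagonal_zero, averageCoeff_zero_right,
    charpoly_rectDiagonal hdm, coeff_prod_X_sub_C_sq h]
  simp only [mul_ite, mul_zero]
  rw [Finset.sum_ite_eq' , if_pos (Finset.mem_range.mpr (by omega)), mul_comm]

theorem expansionCoeff_of_le {m d n k : ℕ} (hdm : d ≤ m) (h : n + k = d) {w : ℕ} (hw : w ≤ d)
    (hkw : k ≤ w) (b : Fin d → ℂ) :
    expansionCoeff m n w b = if w = k then (-1) ^ k else 0 := by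
  -- For w ≥ k the scaling law makes this function constant for t ≠ 0, hence everywhere by
  -- continuity; its value at 0 is then read off from the case b = 0.
  have hc : Continuous fun t : ℂ => t ^ (2 * (w - k)) * expansionCoeff m n w (t • b) :=
    (continuous_pow _).mul
      ((continuous_expansionCoeff m n w).comp (continuous_id.smul continuous_const))
  have heq : (fun t : ℂ => t ^ (2 * (w - k)) * expansionCoeff m n w (t • b)) =
      fun _ => expansionCoeff m n w b := by
    refine hc.ext_on (dense_compl_singleton (0 : ℂ)) continuous_const fun t ht => ?_
    have ht' : t ^ (2 * k) ≠ 0 := pow_ne_zero _ ht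
    refine mul_left_cancel₀ ht' ?_
    rw [← expansionCoeff_smul hdm h b hw, ← mul_assoc, ← pow_add]
    congr 2
    omega
  have h0 := congrFun heq 0
  simp only [zero_smul, expansionCoeff_zero hdm h hw] at h0
  rw [← h0]
  split_ifs with hwk
  · subst hwk; simp
  · simp

/-! ### Polynomial growth from a triangular recurrence -/

theorem exists_bound_of_increment_le (d : ℕ) (u : ℕ → ℕ → ℝ) (hu : ∀ k N, 0 ≤ u k N) (K : ℝ)
    (hK : 0 ≤ K)
    (h : ∀ k ≤ d, ∀ N, 1 ≤ N → u k (N + 1) ≤ u k N + K * ∑ i ∈ Finset.range k, u i N) :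
    ∀ k ≤ d, ∃ D : ℝ, 0 ≤ D ∧ ∀ N : ℕ, 1 ≤ N → u k N ≤ D * (N : ℝ) ^ k := by
  intro k
  induction k using Nat.strong_induction_on with
  | _ k ih =>
    intro hk
    have ih' : ∀ i, ∃ D : ℝ, 0 ≤ D ∧
        (i < k → ∀ N : ℕ, 1 ≤ N → u i N ≤ D * (N : ℝ) ^ i) := fun i => by
      by_cases hi : i < k
      · obtain ⟨D, hD, h'⟩ := ih i hi (by omega)
        exact ⟨D, hD, fun _ => h'⟩
      · exact ⟨0, le_rfl, fun h => absurd h hi⟩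
    choose D hD hDu using ih'
    have hS : 0 ≤ K * ∑ i ∈ Finset.range k, D i :=
      mul_nonneg hK (Finset.sum_nonneg fun i _ => hD i)
    -- The first summand covers N = 1; the second absorbs each increment, which is at most K ∑ D_i ·
    -- N^(k-1) for k > 0.
    refine ⟨u k 1 + K * ∑ i ∈ Finset.range k, D i, add_nonneg (hu _ _) hS, fun N hN => ?_⟩
    induction N, hN using Nat.le_induction with
    | base => simpa using hS
    | succ N hN ihN =>
      have hN' : (1 : ℝ) ≤ N := by exact_mod_cast hN
      -- For k = 0 the increment is an empty sum, and the exponent k - 1 below would be truncated.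
      rcases Nat.eq_zero_or_pos k with hk0 | hk0
      · subst hk0
        have := h 0 hk N hN
        simp at this ihN ⊢
        linarith
      have hsum : ∑ i ∈ Finset.range k, u i N ≤
          (∑ i ∈ Finset.range k, D i) * (N : ℝ) ^ (k - 1) := by
        rw [Finset.sum_mul]
        refine Finset.sum_le_sum fun i hi => ?_
        have hi' := Finset.mem_range.mp hi
        exact (hDu i hi' N hN).trans (mul_le_mul_of_nonneg_left
          (pow_le_pow_right₀ hN' (by omega)) (hD i))
      have hpow : (N : ℝ) ^ k + (N : ℝ) ^ (k - 1) ≤ ((N + 1 : ℕ) : ℝ) ^ k := by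
        obtain ⟨l, rfl⟩ : ∃ l, k = l + 1 := ⟨k - 1, by omega⟩
        have : (N : ℝ) ^ l ≤ ((N : ℝ) + 1) ^ l := by gcongr; linarith
        push_cast
        rw [pow_succ, pow_succ]
        nlinarith
      calc u k (N + 1) ≤ u k N + K * ∑ i ∈ Finset.range k, u i N := h k hk N hN
        _ ≤ (u k 1 + K * ∑ i ∈ Finset.range k, D i) * (N : ℝ) ^ k +
            K * ((∑ i ∈ Finset.range k, D i) * (N : ℝ) ^ (k - 1)) :=
          add_le_add ihN (mul_le_mul_of_nonneg_left hsum hK)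
        _ ≤ (u k 1 + K * ∑ i ∈ Finset.range k, D i) * (N : ℝ) ^ k +
            (u k 1 + K * ∑ i ∈ Finset.range k, D i) * (N : ℝ) ^ (k - 1) := by
          rw [← mul_assoc]
          gcongr
          exact le_add_of_nonneg_left (hu _ _)
        _ ≤ _ := by
          rw [← mul_add]
          exact mul_le_mul_of_nonneg_left hpow (add_nonneg (hu _ _) hS)

/-! ### The recurrence for convolution coefficients -/

/-- The principal square roots of the roots of `p`. -/
def singularValues (d : ℕ) (p : ℂ[X]) : Fin d → ℂ :=
  fun j => (p.roots.toList.getD (j : ℕ) 0) ^ (1 / 2 : ℂ)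

theorem singularMatrix_eq (m d : ℕ) (p : ℂ[X]) :
    singularMatrix m d p = rectDiagonal m (singularValues d p) := rfl

theorem singularValues_sq (d : ℕ) (p : ℂ[X]) (j : Fin d) :
    singularValues d p j ^ 2 = p.roots.toList.getD (j : ℕ) 0 := by
  rw [singularValues, ← Complex.cpow_nat_mul]
  norm_num

theorem coeff_eq_esymmSq_singularValues {d n k : ℕ} (h : n + k = d) {p : ℂ[X]} (hp : p.Monic)
    (hd : p.natDegree = d) : p.coeff n = (-1) ^ k * esymmSq k (singularValues d p) := by
  rw [← coeff_prod_X_sub_C_sq h, ← charpoly_rectDiagonal le_rfl, ← singularMatrix_eq,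
    charpoly_singularMatrix le_rfl hp hd]

theorem coeff_rectConv {m d n : ℕ} (hn : n ≤ d) (p q : ℂ[X]) :
    (rectConv m d p q).coeff n =
      averageCoeff n (rectDiagonal m (singularValues d p))
        (rectDiagonal m (singularValues d q)) := by
  rw [rectConv, haarAverage, finsetSum_coeff]
  simp only [coeff_monomial]
  rw [Finset.sum_ite_eq', if_pos (Finset.mem_range.mpr (by omega))]
  rfl

theorem natDegree_rectConv_le (m d : ℕ) (p q : ℂ[X]) : (rectConv m d p q).natDegree ≤ d := by
  rw [rectConv, haarAverage]
  refine natDegree_sum_le_of_forall_le _ _ fun k hk => ?_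
  exact (natDegree_monomial_le _).trans (by have := Finset.mem_range.mp hk; omega)

theorem averageCoeff_self {m d : ℕ} (A B : Matrix (Fin m) (Fin d) ℂ) :
    averageCoeff d A B = 1 := by
  have h : ∀ M : Matrix (Fin d) (Fin d) ℂ, M.charpoly.coeff d = 1 := fun M => by
    have h1 := M.charpoly_monic.coeff_natDegree
    rwa [M.charpoly_natDegree_eq_dim, Fintype.card_fin] at h1
  simp [averageCoeff, h]

theorem coeff_rectConv_self (m d : ℕ) (p q : ℂ[X]) : (rectConv m d p q).coeff d = 1 := by
  rw [coeff_rectConv le_rfl, averageCoeff_self]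

theorem monic_rectConv (m d : ℕ) (p q : ℂ[X]) : (rectConv m d p q).Monic :=
  monic_of_natDegree_le_of_coeff_eq_one d (natDegree_rectConv_le m d p q)
    (coeff_rectConv_self m d p q)

theorem natDegree_rectConv (m d : ℕ) (p q : ℂ[X]) : (rectConv m d p q).natDegree = d :=
  natDegree_eq_of_le_of_coeff_ne_zero (natDegree_rectConv_le m d p q)
    (by rw [coeff_rectConv_self]; exact one_ne_zero)

/-- Triangularity cuts the expansion at i = k, where the term is exactly the coefficient of `p`.
What remains involves only the coefficients of `p` above index n. -/
theorem coeff_rectConv_eq {m d n k : ℕ} (hdm : d ≤ m) (h : n + k = d) {p : ℂ[X]} (hp : p.Monic)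
    (hd : p.natDegree = d) (q : ℂ[X]) :
    (rectConv m d p q).coeff n = p.coeff n + ∑ i ∈ Finset.range k,
      (-1) ^ i * p.coeff (d - i) * expansionCoeff m n i (singularValues d q) := by
  have he : ∀ i ≤ d, esymmSq i (singularValues d p) = (-1) ^ i * p.coeff (d - i) := by
    intro i hi
    rw [coeff_eq_esymmSq_singularValues (n := d - i) (k := i) (by omega) hp hd, ← mul_assoc,
      ← mul_pow]
    norm_num
  rw [coeff_rectConv (by omega), averageCoeff_eq_sum_esymmSq n hdm,
    ← Finset.sum_subset (s₁ := Finset.range (k + 1))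
      (Finset.range_subset_range.mpr (by omega)), Finset.sum_range_succ, add_comm]
  · congr 1
    · rw [expansionCoeff_of_le hdm h (by omega) le_rfl, if_pos rfl,
        coeff_eq_esymmSq_singularValues h hp hd, mul_comm]
    · refine Finset.sum_congr rfl fun i hi => ?_
      rw [he i (by have := Finset.mem_range.mp hi; omega)]
  · intro w hw hwk
    have hw1 := Finset.mem_range.mp hw
    have hw2 : ¬ w < k + 1 := fun hlt => hwk (Finset.mem_range.mpr hlt)
    rw [expansionCoeff_of_le hdm h (by omega) (by omega), if_neg (by omega), mul_zero]

/-- Each coefficient is continuous, hence bounded on a closed ball; adding the finitely many bounds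
gives a common one. -/
theorem exists_bound_expansionCoeff (m d : ℕ) (ρ : ℝ) :
    ∃ K : ℝ, 0 ≤ K ∧ ∀ n ≤ d, ∀ w ≤ d, ∀ b : Fin d → ℂ, ‖b‖ ≤ ρ →
      ‖expansionCoeff m n w b‖ ≤ K := by
  have h : ∀ n w : ℕ, ∃ K : ℝ, ∀ b ∈ Metric.closedBall (0 : Fin d → ℂ) ρ,
      ‖expansionCoeff m n w b‖ ≤ K := fun n w =>
    (isCompact_closedBall _ _).exists_bound_of_continuousOn
      (continuous_expansionCoeff m n w).continuousOn
  choose K hK using h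
  refine ⟨∑ n ∈ Finset.range (d + 1), ∑ w ∈ Finset.range (d + 1), |K n w|,
    Finset.sum_nonneg fun _ _ => Finset.sum_nonneg fun _ _ => abs_nonneg _, ?_⟩
  intro n hn w hw b hb
  refine (hK n w b (by simpa using hb)).trans ((le_abs_self _).trans ?_)
  refine le_trans (Finset.single_le_sum (f := fun w => |K n w|) (fun _ _ => abs_nonneg _)
    (Finset.mem_range.mpr (Nat.lt_succ_of_le hw))) ?_
  exact Finset.single_le_sum (f := fun n => ∑ w ∈ Finset.range (d + 1), |K n w|)
    (fun _ _ => Finset.sum_nonneg fun _ _ => abs_nonneg _)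
    (Finset.mem_range.mpr (Nat.lt_succ_of_le hn))

/-- A nonnegative root is at most the sum of all roots, which is at most dσ². -/
theorem norm_singularValues_le {d : ℕ} {σ : ℝ} (hd : 1 ≤ d) (r : Fin d → ℝ)
    (hmean : (1 / (d : ℝ)) * ∑ j, (r j) ^ 2 ≤ σ ^ 2) :
    ‖singularValues d (∏ j, (X - C (((r j) ^ 2 : ℝ) : ℂ)))‖ ≤ √(d * σ ^ 2) := by
  have hd' : (0 : ℝ) < d := by exact_mod_cast hd
  have hsum : ∑ j, (r j) ^ 2 ≤ d * σ ^ 2 := by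
    rw [one_div, inv_mul_le_iff₀ hd'] at hmean
    exact hmean
  refine (pi_norm_le_iff_of_nonneg (Real.sqrt_nonneg _)).mpr fun j => ?_
  refine Real.le_sqrt_of_sq_le ?_
  rw [← norm_pow, singularValues_sq]
  set p : ℂ[X] := ∏ j, (X - C (((r j) ^ 2 : ℝ) : ℂ)) with hp
  rcases lt_or_ge (j : ℕ) p.roots.toList.length with hj | hj
  · rw [List.getD_eq_getElem _ _ hj]
    have hmem : p.roots.toList[(j : ℕ)] ∈ p.roots :=
      Multiset.mem_toList.mp (List.getElem_mem hj)
    have hroot := (mem_roots'.mp hmem).2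
    generalize p.roots.toList[(j : ℕ)] = z at hroot ⊢
    rw [IsRoot.def, hp, eval_prod, Finset.prod_eq_zero_iff] at hroot
    obtain ⟨i, -, hi⟩ := hroot
    rw [eval_sub, eval_X, eval_C, sub_eq_zero] at hi
    rw [hi, Complex.norm_real, Real.norm_of_nonneg (sq_nonneg _)]
    exact (Finset.single_le_sum (f := fun i => r i ^ 2) (fun _ _ => sq_nonneg _)
      (Finset.mem_univ i)).trans hsum
  -- Past the end of the root list the default value 0 satisfies the bound trivially.
  · rw [List.getD_eq_default _ _ hj]
    simp
    positivity

theorem monic_rectConvSeq {m d : ℕ} {p : ℕ → ℂ[X]} (h1 : (p 1).Monic)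
    (h1' : (p 1).natDegree = d) (N : ℕ) :
    (rectConvSeq m d p N).Monic ∧ (rectConvSeq m d p N).natDegree = d := by
  match N with
  | 0 => exact ⟨monic_X_pow d, natDegree_X_pow d⟩
  | 1 => exact ⟨h1, h1'⟩
  | N + 2 => exact ⟨monic_rectConv m d _ _, natDegree_rectConv m d _ _⟩

/-! ### Symmetrization, rescaling and the limit -/

theorem coeff_symmetrization (p : ℂ[X]) (l : ℕ) :
    (symmetrization p).coeff l = if 2 ∣ l then p.coeff (l / 2) else 0 := by
  rw [symmetrization, ← expand_eq_comp_X_pow, coeff_expand (by norm_num)]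

theorem natDegree_symmetrization (p : ℂ[X]) :
    (symmetrization p).natDegree = 2 * p.natDegree := by
  rw [symmetrization, natDegree_comp, natDegree_X_pow, mul_comm]

theorem coeff_rescale (α : ℂ) (p : ℂ[X]) (l : ℕ) :
    (rescale α p).coeff l = α ^ p.natDegree * (α⁻¹ ^ l * p.coeff l) := by
  rw [rescale, coeff_C_mul, comp_C_mul_X_coeff, mul_comm (p.coeff l)]

theorem natDegree_rescale_le (α : ℂ) (p : ℂ[X]) : (rescale α p).natDegree ≤ p.natDegree := by
  refine natDegree_le_iff_coeff_eq_zero.mpr fun l hl => ?_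
  rw [coeff_rescale, coeff_eq_zero_of_natDegree_lt hl]
  simp

theorem tendsto_coeff_rescale {d : ℕ} {c : ℕ → ℂ[X]}
    (hc : ∀ N, (c N).Monic ∧ (c N).natDegree = d)
    (hb : ∀ k ≤ d, ∃ D : ℝ, 0 ≤ D ∧ ∀ N : ℕ, 1 ≤ N →
      ‖(c N).coeff (d - k)‖ ≤ D * (N : ℝ) ^ k) (l : ℕ) :
    Tendsto (fun N : ℕ => (rescale (1 / (N : ℂ)) (symmetrization (c N))).coeff l) atTop
      (𝓝 ((X ^ (2 * d) : ℂ[X]).coeff l)) := by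
  have key : ∀ N : ℕ, (rescale (1 / (N : ℂ)) (symmetrization (c N))).coeff l =
      (1 / (N : ℂ)) ^ (2 * d) * ((N : ℂ) ^ l * if 2 ∣ l then (c N).coeff (l / 2) else 0) := by
    intro N
    rw [coeff_rescale, natDegree_symmetrization, (hc N).2, coeff_symmetrization, one_div, inv_inv]
  simp only [key, coeff_X_pow]
  by_cases hl : 2 ∣ l
  swap
  · rw [if_neg (by rintro rfl; exact hl (dvd_mul_right _ _))]
    simp [hl]
  obtain ⟨n, rfl⟩ := hl
  simp only [dvd_mul_right, if_true, Nat.mul_div_cancel_left n two_pos]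
  -- With k = d - n, the factor N^(-2d) · N^(2n) = N^(-2k) beats the growth N^k when n < d and
  -- cancels when n = d; above d the coefficient vanishes.
  rcases lt_trichotomy n d with hn | hn | hn
  · rw [if_neg (by omega)]
    obtain ⟨k, rfl⟩ : ∃ k, d = n + k := ⟨d - n, by omega⟩
    obtain ⟨D, hD, hDb⟩ := hb k (by omega)
    have hlim : Tendsto (fun N : ℕ => D * ((N : ℝ)⁻¹) ^ k) atTop (𝓝 0) := by
      have h0 := (tendsto_inv_atTop_nhds_zero_nat (𝕜 := ℝ)).pow k
      rw [zero_pow (by omega)] at h0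
      simpa using h0.const_mul D
    refine squeeze_zero_norm' ?_ hlim
    filter_upwards [eventually_ge_atTop 1] with N hN
    have hN0 : (N : ℝ) ≠ 0 := by positivity
    have h1 := hDb N hN
    rw [Nat.add_sub_cancel] at h1
    rw [norm_mul, norm_mul, norm_pow, norm_pow, norm_div, norm_one, Complex.norm_natCast]
    calc (1 / (N : ℝ)) ^ (2 * (n + k)) * ((N : ℝ) ^ (2 * n) * ‖(c N).coeff n‖)
        ≤ (1 / (N : ℝ)) ^ (2 * (n + k)) * ((N : ℝ) ^ (2 * n) * (D * (N : ℝ) ^ k)) := by gcongr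
      _ = D * ((N : ℝ)⁻¹) ^ k := by
        have e : (N : ℝ) * (N : ℝ)⁻¹ = 1 := mul_inv_cancel₀ hN0
        rw [one_div]
        generalize (N : ℝ)⁻¹ = a at e ⊢
        calc a ^ (2 * (n + k)) * ((N : ℝ) ^ (2 * n) * (D * (N : ℝ) ^ k))
            = (N * a) ^ (2 * n) * (N * a) ^ k * (D * a ^ k) := by ring
          _ = D * a ^ k := by rw [e]; simp
  · subst hn
    rw [if_pos rfl]
    refine tendsto_const_nhds.congr' ?_
    filter_upwards [eventually_ge_atTop 1] with N hN
    have hN0 : (N : ℂ) ≠ 0 := by exact_mod_cast (by omega : N ≠ 0)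
    have h1 := (hc N).1.coeff_natDegree
    rw [(hc N).2] at h1
    rw [h1, mul_one, ← mul_pow, one_div, inv_mul_cancel₀ hN0, one_pow]
  · rw [if_neg (by omega)]
    have h0 : ∀ N, (c N).coeff n = 0 := fun N =>
      coeff_eq_zero_of_natDegree_lt (by rw [(hc N).2]; exact hn)
    simp [h0]

end RectConv

end

theorem mainTheorem6 (m d : ℕ) (hd : 1 ≤ d) (hdm : d ≤ m) (σ : ℝ)
    (r : ℕ → Fin d → ℝ) (p : ℕ → ℂ[X])
    (hp : ∀ i, 1 ≤ i → p i = ∏ j, (X - C (((r i j) ^ 2 : ℝ) : ℂ)))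
    (hmean : ∀ i, 1 ≤ i → (1 / (d : ℝ)) * ∑ j, (r i j) ^ 2 ≤ σ ^ 2) :
    (∀ k : ℕ, Tendsto
      (fun N : ℕ => (RectConv.rescale (1 / (N : ℂ))
        (RectConv.symmetrization (RectConv.rectConvSeq m d p N))).coeff k)
      atTop (𝓝 ((X ^ (2 * d) : ℂ[X]).coeff k))) ∧
    (∀ x : ℂ, Tendsto
      (fun N : ℕ => (RectConv.rescale (1 / (N : ℂ))
        (RectConv.symmetrization (RectConv.rectConvSeq m d p N))).eval x)
      atTop (𝓝 (x ^ (2 * d)))) := by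
  have h1 : (p 1).Monic := by
    rw [hp 1 le_rfl]
    exact monic_prod_of_monic _ _ fun j _ => monic_X_sub_C _
  have h1' : (p 1).natDegree = d := by
    rw [hp 1 le_rfl, natDegree_prod_of_monic _ _ fun j _ => monic_X_sub_C _]
    simp only [natDegree_X_sub_C, Finset.sum_const, Finset.card_univ, Fintype.card_fin,
      smul_eq_mul, mul_one]
  have hc := RectConv.monic_rectConvSeq (m := m) h1 h1'
  obtain ⟨K, hK, hKb⟩ := RectConv.exists_bound_expansionCoeff m d (√(d * σ ^ 2))
  have hb := RectConv.exists_bound_of_increment_le d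
    (fun k N => ‖(RectConv.rectConvSeq m d p N).coeff (d - k)‖) (fun _ _ => norm_nonneg _) K hK
    (by
      intro k hk N hN
      -- The convolution step of `rectConvSeq` starts at index 2, so N ≥ 1 is written as a successor
      -- to unfold it.
      obtain ⟨N, rfl⟩ : ∃ M, N = M + 1 := ⟨N - 1, by omega⟩
      change ‖(RectConv.rectConv m d (RectConv.rectConvSeq m d p (N + 1)) (p (N + 2))).coeff
        (d - k)‖ ≤ _
      rw [RectConv.coeff_rectConv_eq (k := k) hdm (by omega) (hc (N + 1)).1 (hc (N + 1)).2]
      refine (norm_add_le _ _).trans (add_le_add le_rfl ?_)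
      rw [Finset.mul_sum]
      refine (norm_sum_le _ _).trans (Finset.sum_le_sum fun i hi => ?_)
      have hi' := Finset.mem_range.mp hi
      rw [norm_mul, norm_mul, norm_pow, norm_neg, norm_one, one_pow, one_mul, mul_comm]
      refine mul_le_mul_of_nonneg_right (hKb _ (by omega) _ (by omega) _ ?_) (norm_nonneg _)
      rw [hp (N + 2) (by omega)]
      exact RectConv.norm_singularValues_le hd _ (hmean (N + 2) (by omega)))
  have hcoeff := RectConv.tendsto_coeff_rescale hc hb
  refine ⟨hcoeff, fun x => ?_⟩
  -- A degree bound uniform in N turns evaluation into a sum over a fixed finite range, so pointwise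
  -- convergence follows from that of the coefficients.
  have hdeg : ∀ N : ℕ, (RectConv.rescale (1 / (N : ℂ))
      (RectConv.symmetrization (RectConv.rectConvSeq m d p N))).natDegree < 2 * d + 1 := by
    intro N
    refine Nat.lt_succ_of_le ((RectConv.natDegree_rescale_le _ _).trans ?_)
    rw [RectConv.natDegree_symmetrization, (hc N).2]
  have hX : x ^ (2 * d) = ∑ l ∈ Finset.range (2 * d + 1),
      (X ^ (2 * d) : ℂ[X]).coeff l * x ^ l := by
    rw [← eval_eq_sum_range' (by simp), eval_pow, eval_X]
  rw [hX]
  simp only [fun N => eval_eq_sum_range' (hdeg N) x]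
  exact tendsto_finsetSum _ fun l _ => (hcoeff l).mul_const _
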